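/- **Theorem 4 (exact outage probability of select-max relaying).** A source $S$ communicates with a destination $D$ through $N\ge 1$ decode-and-forward relays $R_1,\dots,R_N$. For each of the $2N$ links $AB\in\{SR_b,\,R_bD : 1\le b\le N\}$ let $\alpha_{AB},\beta_{AB},\bar h_{AB},\rho_{AB}>0$, and let $\tilde h_{AB}$ be a random variable with the Gamma-Gamma density $$f_{AB}(x)=\frac{2(\alpha_{AB}\beta_{AB})^{(\alpha_{AB}+\beta_{AB})/2}}{\Gamma(\alpha_{AB})\Gamma(\beta_{AB})}\,x^{\frac{\alpha_{AB}+\beta_{AB}}2-1}K_{\alpha_{AB}-\beta_{AB}}\!\left(2\sqrt{\alpha_{AB}\beta_{AB}x}\right),\qquad x>0,$$ where $K_\nu$ is the modified Bessel function of the second kind; the $2N$ variables $\tilde h_{AB}$ are independent. Let $\eta,T_b,P_t,N_0,\gamma_{th}>0$, let the instantaneous SNR of link $AB$ be $\gamma_{AB}=\eta^2\rho_{AB}^2T_b^2P_t^2h_{AB}^2/N_0$ with $h_{AB}=\bar h_{AB}\tilde h_{AB}$, and let $P_M=\eta T_bP_t/\sqrt{N_0\gamma_{th}}$ be the power margin.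 In each state the select-max protocol activates only a relay $R_b$ that maximizes $\min(\gamma_{SR_i},\gamma_{R_iD})$ over $i\in\{1,\dots,N\}$ (ties broken arbitrarily), and an outage occurs if $\gamma_{SR_b}<\gamma_{th}$ or $\gamma_{R_bD}<\gamma_{th}$ for that relay. Then, for every link $AB$, the outage probability $\Pr\{\gamma_{AB}<\gamma_{th}\}$ equals the Gamma-Gamma cumulative distribution function $\Pr\{\tilde h_{AB}\le x\}$ at $x=1/(\bar h_{AB}\rho_{AB}P_M)$, and equals $$F_{AB}=\frac{1}{\Gamma(\alpha_{AB})\Gamma(\beta_{AB})}\,G_{1,3}^{2,1}\!\left[\frac{\alpha_{AB}\beta_{AB}}{\bar h_{AB}\rho_{AB}P_M}\,\middle|\,\begin{array}{c}1\\ \alpha_{AB},\beta_{AB},0\end{array}\right];$$ and the outage probability of the select-max system is $$P_{out}=\prod_{b=1}^{N}\Bigl(1-(1-F_{SR_b})(1-F_{R_bD})\Bigr).$$ Here $G_{1,3}^{2,1}$ is Meijer's $G$-function, that is, for $z>0$ and any $0<c<\min(\alpha,\beta)$, $$G_{1,3}^{2,1}\!\left[z\,\middle|\,\begin{array}{c}1\\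 \alpha,\beta,0\end{array}\right]=\frac1{2\pi i}\int_{c-i\infty}^{c+i\infty}\frac{\Gamma(\alpha-s)\Gamma(\beta-s)\Gamma(s)}{\Gamma(1+s)}\,z^s\,ds .$$ -/

import Mathlib

namespace FSO

noncomputable section

/-! ### Special functions -/

/-- The modified Bessel function of the second kind `K_ν(x)`, for real order `ν` and `x > 0`:
`K_ν(x) = (1/2) (x/2)^ν ∫_0^∞ exp(-t - x²/(4t)) t^(-ν-1) dt`. -/
def besselK (ν x : ℝ) : ℝ :=
  1 / 2 * (x / 2) ^ ν *
    ∫ t in Set.Ioi (0 : ℝ), Real.exp (-t - x ^ 2 / (4 * t)) * t ^ (-ν - 1)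

/-- The integrand of the Mellin-Barnes integral of Meijer's `G^{m,n}_{p,q}[z | a; b]`:
`∏_{j ≤ m} Γ(b_j - s) ∏_{j ≤ n} Γ(1 - a_j + s)` divided by
`∏_{m < j ≤ q} Γ(1 - b_j + s) ∏_{n < j ≤ p} Γ(a_j - s)`, times `z^s`.
(Mathlib's `Complex.Gamma` vanishes at the poles and `x / 0 = 0`, so the reciprocal Gamma
factors have their correct value `0` there.) -/
def meijerGIntegrand (m n : ℕ) {p q : ℕ} (a : Fin p → ℂ) (b : Fin q → ℂ) (z s : ℂ) : ℂ :=
  ((∏ j : Fin q, if (j : ℕ) < m then Complex.Gamma (b j - s) else 1) *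
      (∏ j : Fin p, if (j : ℕ) < n then Complex.Gamma (1 - a j + s) else 1)) /
    ((∏ j : Fin q, if (j : ℕ) < m then 1 else Complex.Gamma (1 - b j + s)) *
      (∏ j : Fin p, if (j : ℕ) < n then 1 else Complex.Gamma (a j - s))) * z ^ s

/-- The vertical line `Re s = c` separates the poles of `Γ(b_j - s)`, `j ≤ m` (to its right),
from the poles of `Γ(1 - a_j + s)`, `j ≤ n` (to its left). -/
def IsSeparatingLine (m n : ℕ) {p q : ℕ} (a : Fin p → ℂ) (b : Fin q → ℂ) (c : ℝ) : Prop :=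
  (∀ j : Fin q, (j : ℕ) < m → c < (b j).re) ∧
    (∀ j : Fin p, (j : ℕ) < n → (a j).re - 1 < c)

open Classical in
/-- Meijer's `G`-function `G^{m,n}_{p,q}[z | a; b]`, for parameters for which a vertical line
separates the two families of poles: `1/(2πi)` times the integral of the Mellin-Barnes integrand
from `c - i∞` to `c + i∞` along such a line `s = c + i t`, `ds = i dt`.  By Cauchy's theorem the
value does not depend on the line. The value is set to `0` if there is no separating line. -/
def meijerG (m n : ℕ) {p q : ℕ} (a : Fin p → ℂ) (b : Fin q → ℂ) (z : ℂ) : ℂ :=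
  if h : ∃ c : ℝ, IsSeparatingLine m n a b c then
    1 / (2 * (Real.pi : ℂ) * Complex.I) *
      ∫ t : ℝ, meijerGIntegrand m n a b z ((h.choose : ℂ) + t * Complex.I) * Complex.I
  else 0

/-! ### The Gamma-Gamma distribution -/

/-- The Gamma-Gamma probability density with parameters `α, β > 0`. -/
def gammaGammaPDF (α β x : ℝ) : ℝ :=
  if 0 < x then
    2 * (α * β) ^ ((α + β) / 2) / (Real.Gamma α * Real.Gamma β) * x ^ ((α + β) / 2 - 1) *
      besselK (α - β) (2 * Real.sqrt (α * β * x))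
  else 0

/-- The Gamma-Gamma distribution with parameters `α, β > 0`. -/
def gammaGammaMeasure (α β : ℝ) : MeasureTheory.Measure ℝ :=
  MeasureTheory.volume.withDensity fun x => ENNReal.ofReal (gammaGammaPDF α β x)

/-- The cumulative distribution function of the Gamma-Gamma distribution. -/
def gammaGammaCDF (α β x : ℝ) : ℝ :=
  (gammaGammaMeasure α β).real (Set.Iic x)

/-! ### The relaying system -/

/-- The two hops of a path through a relay: source-relay and relay-destination. -/
inductive Hop where
  | SR
  | RD

/-- The (deterministic) parameters of a relay-assisted free-space optical system with `N` relays.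
The link `(b, k)` is the source-relay (`k = SR`) or relay-destination (`k = RD`) link of
relay `b`. -/
structure RelaySystem (N : ℕ) where
  /-- responsivity of the photodetector -/
  η : ℝ
  /-- slot duration -/
  Tb : ℝ
  /-- total optical power -/
  Pt : ℝ
  /-- the noise variance is `N₀ / 2` -/
  N₀ : ℝ
  /-- threshold SNR, common to all links -/
  γth : ℝ
  /-- path loss coefficients of the links -/
  hbar : Fin N → Hop → ℝ
  /-- fraction of the total power allocated to each link when its relay is the active one -/
  ρ : Fin N → Hop → ℝ
  /-- first Gamma-Gamma parameter of each link -/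
  α : Fin N → Hop → ℝ
  /-- second Gamma-Gamma parameter of each link -/
  β : Fin N → Hop → ℝ
  η_pos : 0 < η
  Tb_pos : 0 < Tb
  Pt_pos : 0 < Pt
  N₀_pos : 0 < N₀
  γth_pos : 0 < γth
  hbar_pos : ∀ b k, 0 < hbar b k
  ρ_pos : ∀ b k, 0 < ρ b k
  α_pos : ∀ b k, 0 < α b k
  β_pos : ∀ b k, 0 < β b k

namespace RelaySystem

variable {N : ℕ} {Ω : Type*} (S : RelaySystem N)

/-- The power margin `P_M = η T_b P_t / √(N₀ γ_th)`. -/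
def powerMargin : ℝ := S.η * S.Tb * S.Pt / Real.sqrt (S.N₀ * S.γth)

/-- The channel gain of a link: path loss times turbulence-induced fading. -/
def gain (fading : Fin N → Hop → Ω → ℝ) (b : Fin N) (k : Hop) (ω : Ω) : ℝ :=
  S.hbar b k * fading b k ω

/-- The instantaneous SNR of a link. -/
def snr (fading : Fin N → Hop → Ω → ℝ) (b : Fin N) (k : Hop) (ω : Ω) : ℝ :=
  S.η ^ 2 * S.ρ b k ^ 2 * S.Tb ^ 2 * S.Pt ^ 2 * S.gain fading b k ω ^ 2 / S.N₀

/-- The min equivalent SNR of the path through relay `b`. -/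
def pathSNR (fading : Fin N → Hop → Ω → ℝ) (b : Fin N) (ω : Ω) : ℝ :=
  min (S.snr fading b Hop.SR ω) (S.snr fading b Hop.RD ω)

/-- `sel` is a select-max rule: in every state `ω` it activates a relay that maximizes the
min equivalent SNR (ties may be broken in any way). -/
def IsSelectMax (fading : Fin N → Hop → Ω → ℝ) (sel : Ω → Fin N) : Prop :=
  ∀ ω i, S.pathSNR fading i ω ≤ S.pathSNR fading (sel ω) ω

/-- The event that the link `(b, k)` is in outage. -/
def linkOutage (fading : Fin N → Hop → Ω → ℝ) (b : Fin N) (k : Hop) : Set Ω :=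
  {ω | S.snr fading b k ω < S.γth}

/-- The outage event of decode-and-forward relaying when the relay `sel ω` is the only active
one: the active relay or the destination fails to decode. -/
def outage (fading : Fin N → Hop → Ω → ℝ) (sel : Ω → Fin N) : Set Ω :=
  {ω | ω ∈ S.linkOutage fading (sel ω) Hop.SR ∨ ω ∈ S.linkOutage fading (sel ω) Hop.RD}

/-- The closed form of the outage probability of the link `(b, k)`:
`1 / (Γ(α) Γ(β)) · G^{2,1}_{1,3}[α β / (h̄ ρ P_M) | 1; α, β, 0]`. -/
def linkOutageFormula (b : Fin N) (k : Hop) : ℂ :=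
  1 / (Complex.Gamma (S.α b k) * Complex.Gamma (S.β b k)) *
    meijerG 2 1 ![(1 : ℂ)] ![(S.α b k : ℂ), (S.β b k : ℂ), 0]
      ((S.α b k * S.β b k / (S.hbar b k * S.ρ b k * S.powerMargin) : ℝ) : ℂ)

end RelaySystem

end

end FSO

/-!
The Gamma-Gamma distribution function `F` is recovered from its Mellin transform. Writing out the
integral that defines `K_ν` shows that the density is, up to a power of `x`, the multiplicative
convolution of `exp(-αβu)` with `t ^ (β - α) exp(-t)` (`gammaGammaPDF_eq`), and `F` is in turn a
multiplicative convolution of the indicator of `[1, ∞)` with `t` times the density. Mellin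
transforms turn multiplicative convolutions into products (`hasMellin_mulConv`), and those of the
factors are Gamma functions and `-1 / s`, so for `-min(α, β) < Re s < 0` the transform of `F` is
`-(1 / s) (αβ) ^ (-s) Γ(α + s) Γ(β + s) / (Γ(α) Γ(β))` (`hasMellin_gammaGammaCDF`). This is
integrable on vertical lines, and `F` is continuous, so Mellin inversion applies. As
`Γ(s) / Γ(1 + s) = 1 / s`, the inversion integral is the Mellin-Barnes integral of Meijer's
`G`-function with `s` replaced by `-s` (`gammaGammaCDF_eq_meijerG`).

For the system, a link is in outage when the modulus of its fading variable is below
`1 / (h̄ ρ P_M)` (`RelaySystem.linkOutage_eq_preimage`), and as the selected relay maximizes the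
minimal SNR, the system is in outage if and only if every path is
(`RelaySystem.outage_eq_iInter`). Independence of the links then gives the product formula
(`measureReal_iInter_union_of_iIndepFun`).
-/

namespace FSO

section Mellin

open MeasureTheory Set Complex Filter Topology

/-! ### Multiplicative convolution and Mellin transforms -/

/-- The multiplicative convolution `x ↦ ∫_0^∞ g(x / t) h(t) dt / t` of two functions on the
positive half-line; the values of `h` on `(-∞, 0]` do not matter. -/
noncomputable def mulConv (g h : ℝ → ℂ) (x : ℝ) : ℂ :=
  ∫ t in Ioi (0 : ℝ), g (x / t) * (h t / t)

/-- The Mellin transform turns multiplicative convolution into multiplication, by Fubini's theorem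
and the substitution `x = t u`. -/
theorem hasMellin_mulConv {g h : ℝ → ℂ} {s a b : ℂ} (hgm : Measurable g)
    (hg : HasMellin g s a) (hh : HasMellin h s b) : HasMellin (mulConv g h) s (a * b) := by
  obtain ⟨hgc, rfl⟩ := hg
  obtain ⟨hhc, rfl⟩ := hh
  set μ : Measure ℝ := volume.restrict (Ioi 0)
  have hpos : ∀ᵐ t ∂μ, t ∈ Ioi (0 : ℝ) := ae_restrict_mem measurableSet_Ioi
  set F : ℝ × ℝ → ℂ := fun p => (p.1 : ℂ) ^ (s - 1) * (g (p.1 / p.2) * (h p.2 / p.2))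
  -- measurability of `h` is implicit in the convergence of its Mellin transform
  have hhm : AEStronglyMeasurable h μ := by
    have h1 : AEStronglyMeasurable (fun t : ℝ => (t : ℂ) ^ (s - 1) • h t) μ :=
      hhc.aestronglyMeasurable
    have h2 : AEStronglyMeasurable (fun t : ℝ => (t : ℂ) ^ (1 - s)) μ := by
      apply Measurable.aestronglyMeasurable; fun_prop
    refine (h2.mul h1).congr ?_
    filter_upwards [hpos] with t ht
    have ht0 : (t : ℂ) ≠ 0 := ofReal_ne_zero.2 ht.ne'
    simp only [Pi.mul_apply, smul_eq_mul]
    rw [← mul_assoc, ← cpow_add _ _ ht0]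
    simp
  have hFm : AEStronglyMeasurable F (μ.prod μ) := by
    have h1 : Measurable (fun p : ℝ × ℝ => (p.1 : ℂ) ^ (s - 1)) := by fun_prop
    have h2 : Measurable (fun p : ℝ × ℝ => g (p.1 / p.2)) := by fun_prop
    have h3 : AEStronglyMeasurable (fun p : ℝ × ℝ => h p.2 / p.2) (μ.prod μ) := by
      have : AEStronglyMeasurable (fun t : ℝ => h t / t) μ :=
        (hhm.aemeasurable.div (by fun_prop)).aestronglyMeasurable
      exact this.comp_snd
    exact h1.aestronglyMeasurable.mul (h2.aestronglyMeasurable.mul h3)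
  have hgt : ∀ t : ℝ, 0 < t → MellinConvergent (fun x => g (x / t)) s ∧
      mellin (fun x => g (x / t)) s = (t : ℂ) ^ s * mellin g s := by
    intro t ht
    have e : (fun x => g (x / t)) = fun x => g (t⁻¹ * x) := by
      funext x; rw [div_eq_inv_mul]
    rw [e, mellin_comp_mul_left _ _ (inv_pos.2 ht), MellinConvergent.comp_mul_left (inv_pos.2 ht)]
    refine ⟨hgc, ?_⟩
    rw [smul_eq_mul, ofReal_inv, inv_cpow _ _ (by rw [arg_ofReal_of_nonneg ht.le]; exact Real.pi_pos.ne),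
      cpow_neg, inv_inv]
  -- the inner integral in `x`, for fixed `t`
  have hinner : ∀ t : ℝ, 0 < t → ∫ x, F (x, t) ∂μ = mellin g s * ((t : ℂ) ^ (s - 1) * h t) := by
    intro t ht
    have ht0 : (t : ℂ) ≠ 0 := ofReal_ne_zero.2 ht.ne'
    have e : ∀ x, F (x, t) = ((x : ℂ) ^ (s - 1) • g (x / t)) * (h t / t) := by
      intro x; simp only [F, smul_eq_mul]; ring
    simp_rw [e]
    rw [integral_mul_const]
    have := (hgt t ht).2
    rw [mellin] at this
    rw [this, cpow_sub _ _ ht0, cpow_one]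
    ring
  have hFi : Integrable F (μ.prod μ) := by
    rw [integrable_prod_iff' hFm]
    refine ⟨?_, ?_⟩
    · filter_upwards [hpos] with t ht
      have : Integrable (fun x : ℝ => ((x : ℂ) ^ (s - 1) • g (x / t)) * (h t / t)) μ :=
        (hgt t ht).1.mul_const _
      refine this.congr (ae_of_all _ fun x => ?_)
      simp only [F, smul_eq_mul]; ring
    · have hn : Integrable (fun t : ℝ => (∫ u, ‖(u : ℂ) ^ (s - 1) • g u‖ ∂μ) *
          ‖(t : ℂ) ^ (s - 1) • h t‖) μ := hhc.norm.const_mul _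
      refine hn.congr ?_
      filter_upwards [hpos] with t ht
      have ht' : (0 : ℝ) < t := ht
      have hsub := integral_comp_mul_left_Ioi (fun u : ℝ => ‖(u : ℂ) ^ (s - 1) • g u‖) 0
        (inv_pos.2 ht')
      rw [mul_zero, inv_inv] at hsub
      have e : ∀ᵐ x ∂μ, ‖F (x, t)‖ =
          ‖((t⁻¹ * x : ℝ) : ℂ) ^ (s - 1) • g (t⁻¹ * x)‖ * (t ^ (s.re - 1) * (‖h t‖ / t)) := by
        filter_upwards [hpos] with x hx
        have hx' : (0 : ℝ) < x := hx
        have hxt : 0 < t⁻¹ * x := by positivity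
        simp only [F, norm_smul, norm_mul, norm_div]
        rw [norm_cpow_eq_rpow_re_of_pos hx', norm_cpow_eq_rpow_re_of_pos hxt,
          Real.mul_rpow (by positivity) hx'.le, Real.inv_rpow ht'.le, sub_re, one_re,
          div_eq_inv_mul x t, norm_real, Real.norm_of_nonneg ht'.le]
        have : t ^ (s.re - 1) ≠ 0 := (Real.rpow_pos_of_pos ht' _).ne'
        field_simp
      rw [integral_congr_ae e, integral_mul_const, hsub, norm_smul,
        norm_cpow_eq_rpow_re_of_pos ht', sub_re, one_re, smul_eq_mul]
      field_simp
      exact mul_comm _ _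
  -- Fubini: the inner integral in `t` is the convolution
  have hswap := integral_integral_swap (f := fun x t => F (x, t)) hFi
  have hconv : ∀ x : ℝ, ∫ t, F (x, t) ∂μ = (x : ℂ) ^ (s - 1) • mulConv g h x := by
    intro x
    simp only [F]
    rw [integral_const_mul, smul_eq_mul, mulConv]
  refine ⟨?_, ?_⟩
  · have := hFi.integral_prod_left
    exact this.congr (ae_of_all _ fun x => hconv x)
  · have e1 : mellin (mulConv g h) s = ∫ x, ∫ t, F (x, t) ∂μ ∂μ := by
      rw [mellin]; exact integral_congr_ae (ae_of_all _ fun x => (hconv x).symm)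
    rw [e1, hswap]
    have e2 : ∀ᵐ t ∂μ, ∫ x, F (x, t) ∂μ = mellin g s * ((t : ℂ) ^ (s - 1) • h t) := by
      filter_upwards [hpos] with t ht using hinner t ht
    rw [integral_congr_ae e2, integral_const_mul]
    rfl

theorem hasMellin_exp_neg_mul {c : ℝ} (hc : 0 < c) {s : ℂ} (hs : 0 < s.re) :
    HasMellin (fun t : ℝ => ((Real.exp (-(c * t)) : ℝ) : ℂ)) s ((c : ℂ) ^ (-s) * Gamma s) := by
  have h1 : MellinConvergent (fun t : ℝ => ((Real.exp (-t) : ℝ) : ℂ)) s := by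
    refine (GammaIntegral_convergent hs).congr (ae_of_all _ fun t => ?_)
    simp [mul_comm]
  refine ⟨(MellinConvergent.comp_mul_left hc).2 h1, ?_⟩
  rw [mellin_comp_mul_left (fun t : ℝ => ((Real.exp (-t) : ℝ) : ℂ)) s hc,
    Gamma_eq_integral hs, GammaIntegral_eq_mellin, smul_eq_mul]

/-- Multiplicative convolution with `1_{[1, ∞)}` is integration of `h(t) / t` over `(0, x]`; its
Mellin factor `-1 / s` is what turns the Mellin transform of a density into that of the
distribution function. -/
theorem hasMellin_indicator_Ici {s : ℂ} (hs : s.re < 0) :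
    HasMellin ((Ici (1 : ℝ)).indicator fun _ => (1 : ℂ)) s (-(1 / s)) := by
  have hsub : Ici (1 : ℝ) ⊆ Ioi 0 := fun x hx => mem_Ioi.2 (one_pos.trans_le (mem_Ici.1 hx))
  have e : (fun t : ℝ => (t : ℂ) ^ (s - 1) • (Ici (1 : ℝ)).indicator (fun _ => (1 : ℂ)) t) =
      (Ici (1 : ℝ)).indicator fun t : ℝ => (t : ℂ) ^ (s - 1) := by
    funext t; by_cases ht : t ∈ Ici (1 : ℝ) <;> simp [ht]
  have hre : (s - 1).re < -1 := by rw [sub_re, one_re]; linarith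
  refine ⟨?_, ?_⟩
  · rw [MellinConvergent, e, IntegrableOn, integrable_indicator_iff measurableSet_Ici, IntegrableOn,
      Measure.restrict_restrict measurableSet_Ici, inter_eq_left.2 hsub, ← IntegrableOn,
      integrableOn_Ici_iff_integrableOn_Ioi]
    exact integrableOn_Ioi_cpow_of_lt hre one_pos
  · rw [mellin, e, setIntegral_indicator measurableSet_Ici, inter_eq_right.2 hsub,
      integral_Ici_eq_integral_Ioi, integral_Ioi_cpow_of_lt hre one_pos]
    simp [neg_div]

theorem norm_Gamma_le_Gamma_re {s : ℂ} (hs : 0 < s.re) : ‖Gamma s‖ ≤ Real.Gamma s.re := by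
  rw [Gamma_eq_integral hs, GammaIntegral, Real.Gamma_eq_integral hs]
  refine (norm_integral_le_integral_norm _).trans_eq ?_
  refine setIntegral_congr_fun measurableSet_Ioi fun x hx => ?_
  have hx' : (0 : ℝ) < x := hx
  simp only [norm_mul, norm_cpow_eq_rpow_re_of_pos hx', norm_real, Real.norm_of_nonneg (Real.exp_pos _).le,
    sub_re, one_re]

/-- A crude decay estimate for `Γ` on vertical lines, `|Γ(s)| ≤ Γ(Re s + 1) / |s|`; it comes from
`s Γ(s) = Γ(s + 1)`. -/
theorem norm_Gamma_mul_norm_le {s : ℂ} (hs : 0 < s.re) :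
    ‖Gamma s‖ * ‖s‖ ≤ Real.Gamma (s.re + 1) := by
  have h0 : s ≠ 0 := by rintro rfl; simp at hs
  have := norm_Gamma_le_Gamma_re (s := s + 1) (by simp; linarith)
  rw [Gamma_add_one _ h0, norm_mul, add_re, one_re] at this
  linarith

/-! ### The Gamma-Gamma distribution and its Mellin transform -/

/-- The Gamma-Gamma density is `x ^ (α - 1)` times the multiplicative convolution of
`u ↦ exp(-αβu)` and `t ↦ t ^ (β - α) exp(-t)`, up to a constant. The factor `1` in `exp(-(1 * t))`
makes both exponentials of the form treated in `hasMellin_exp_neg_mul`. -/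
theorem gammaGammaPDF_eq {α β x : ℝ} (hα : 0 < α) (hβ : 0 < β) (hx : 0 < x) :
    gammaGammaPDF α β x = (α * β) ^ α / (Real.Gamma α * Real.Gamma β) * (x ^ (α - 1) *
      ∫ t in Ioi (0 : ℝ), Real.exp (-(α * β * (x / t))) * (t ^ (β - α) * Real.exp (-(1 * t)) / t)) := by
  have hab : 0 < α * β := mul_pos hα hβ
  have habx : 0 < α * β * x := mul_pos hab hx
  have hint : ∫ t in Ioi (0 : ℝ), Real.exp (-t - (2 * √(α * β * x)) ^ 2 / (4 * t)) *
        t ^ (-(α - β) - 1) =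
      ∫ t in Ioi (0 : ℝ), Real.exp (-(α * β * (x / t))) *
        (t ^ (β - α) * Real.exp (-(1 * t)) / t) := by
    refine setIntegral_congr_fun measurableSet_Ioi fun t ht => ?_
    have ht' : (0 : ℝ) < t := ht
    have e1 : -t - (2 * √(α * β * x)) ^ 2 / (4 * t) = -(α * β * (x / t)) + -(1 * t) := by
      rw [mul_pow, Real.sq_sqrt habx.le]
      field_simp
      ring
    rw [e1, Real.exp_add, Real.rpow_sub_one ht'.ne', neg_sub]
    ring
  have hpow : (α * β) ^ ((α + β) / 2) * x ^ ((α + β) / 2 - 1) * √(α * β * x) ^ (α - β) =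
      (α * β) ^ α * x ^ (α - 1) := by
    rw [Real.sqrt_eq_rpow, ← Real.rpow_mul habx.le, Real.mul_rpow hab.le hx.le]
    calc _ = ((α * β) ^ ((α + β) / 2) * (α * β) ^ (1 / 2 * (α - β))) *
          (x ^ ((α + β) / 2 - 1) * x ^ (1 / 2 * (α - β))) := by ring
      _ = _ := by
        rw [← Real.rpow_add hab, ← Real.rpow_add hx]
        congr 2 <;> ring
  rw [gammaGammaPDF, if_pos hx, besselK, hint, mul_div_cancel_left₀ _ (two_ne_zero' ℝ)]
  set J := ∫ t in Ioi (0 : ℝ), Real.exp (-(α * β * (x / t))) *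
        (t ^ (β - α) * Real.exp (-(1 * t)) / t)
  calc _ = ((α * β) ^ ((α + β) / 2) * x ^ ((α + β) / 2 - 1) * √(α * β * x) ^ (α - β)) /
        (Real.Gamma α * Real.Gamma β) * J := by ring
    _ = _ := by rw [hpow]; ring

theorem gammaGammaPDF_nonneg {α β : ℝ} (hα : 0 < α) (hβ : 0 < β) (x : ℝ) :
    0 ≤ gammaGammaPDF α β x := by
  by_cases hx : 0 < x
  · rw [gammaGammaPDF_eq hα hβ hx]
    have := Real.Gamma_pos_of_pos hα
    have := Real.Gamma_pos_of_pos hβ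
    refine mul_nonneg (by positivity) (mul_nonneg (by positivity) ?_)
    refine setIntegral_nonneg measurableSet_Ioi fun t ht => ?_
    have ht' : (0 : ℝ) < t := ht
    positivity
  · rw [gammaGammaPDF, if_neg hx]

theorem hasMellin_gammaGammaPDF {α β : ℝ} (hα : 0 < α) (hβ : 0 < β) {s : ℂ}
    (h1 : 0 < (α + s).re) (h2 : 0 < (β + s).re) :
    HasMellin (fun x => (gammaGammaPDF α β x : ℂ)) (s + 1)
      (((α * β : ℝ) : ℂ) ^ (-s) * (Gamma (α + s) * Gamma (β + s)) / (Gamma α * Gamma β)) := by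
  have hab : 0 < α * β := mul_pos hα hβ
  have hab0 : ((α * β : ℝ) : ℂ) ≠ 0 := ofReal_ne_zero.2 hab.ne'
  set g : ℝ → ℂ := fun u => ((Real.exp (-(α * β * u)) : ℝ) : ℂ)
  set h : ℝ → ℂ := fun t => (t : ℂ) ^ ((β : ℂ) - α) • ((Real.exp (-(1 * t)) : ℝ) : ℂ)
  have hg : HasMellin g (α + s) (((α * β : ℝ) : ℂ) ^ (-(α + s)) * Gamma (α + s)) :=
    hasMellin_exp_neg_mul hab h1
  have hh : HasMellin h (α + s) (Gamma (β + s)) := by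
    have e : (α : ℂ) + s + (β - α) = β + s := by ring
    have := hasMellin_exp_neg_mul one_pos h2
    rw [HasMellin, MellinConvergent.cpow_smul, mellin_cpow_smul, e]
    simpa [HasMellin] using this
  have hgm : Measurable g := by fun_prop
  have hc := hasMellin_mulConv hgm hg hh
  set C : ℂ := ((α * β : ℝ) : ℂ) ^ (α : ℂ) / (Gamma α * Gamma β)
  have hval : ∀ x ∈ Ioi (0 : ℝ), (gammaGammaPDF α β x : ℂ) =
      C • ((x : ℂ) ^ ((α : ℂ) - 1) • mulConv g h x) := by
    intro x hx
    have hx' : (0 : ℝ) < x := hx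
    have hm : mulConv g h x = ((∫ t in Ioi (0 : ℝ), Real.exp (-(α * β * (x / t))) *
        (t ^ (β - α) * Real.exp (-(1 * t)) / t) : ℝ) : ℂ) := by
      rw [mulConv, ← integral_complex_ofReal]
      refine setIntegral_congr_fun measurableSet_Ioi fun t ht => ?_
      simp only [g, h, smul_eq_mul]
      rw [← ofReal_sub, ← ofReal_cpow (le_of_lt ht)]
      push_cast
      rfl
    rw [gammaGammaPDF_eq hα hβ hx', hm]
    simp only [C, smul_eq_mul, Complex.Gamma_ofReal]
    rw [← ofReal_one, ← ofReal_sub, ← ofReal_cpow hx'.le, ← ofReal_cpow hab.le]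
    push_cast
    rfl
  have hs : s + 1 + ((α : ℂ) - 1) = α + s := by ring
  have hM : HasMellin (fun x : ℝ => C • ((x : ℂ) ^ ((α : ℂ) - 1) • mulConv g h x)) (s + 1)
      (C * (((α * β : ℝ) : ℂ) ^ (-(α + s)) * Gamma (α + s) * Gamma (β + s))) := by
    have hc1 : MellinConvergent (fun x : ℝ => (x : ℂ) ^ ((α : ℂ) - 1) • mulConv g h x) (s + 1) := by
      rw [MellinConvergent.cpow_smul, hs]; exact hc.1
    have := hasMellin_const_smul hc1 C
    rwa [mellin_cpow_smul, hs, hc.2, smul_eq_mul] at this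
  have hfin : C * (((α * β : ℝ) : ℂ) ^ (-(α + s)) * Gamma (α + s) * Gamma (β + s)) =
      ((α * β : ℝ) : ℂ) ^ (-s) * (Gamma (α + s) * Gamma (β + s)) / (Gamma α * Gamma β) := by
    have : ((α * β : ℝ) : ℂ) ^ (-s) =
        ((α * β : ℝ) : ℂ) ^ (α : ℂ) * ((α * β : ℝ) : ℂ) ^ (-(α + s)) := by
      rw [← cpow_add _ _ hab0]; congr 1; ring
    simp only [C]
    rw [this]; ring
  rw [← hfin, ← hM.2]
  refine ⟨?_, ?_⟩
  · refine (integrableOn_congr_fun (fun x hx => ?_) measurableSet_Ioi).1 hM.1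
    simp only [hval x hx]
  · refine setIntegral_congr_fun measurableSet_Ioi fun x hx => ?_
    simp only [hval x hx]

theorem integrableOn_gammaGammaPDF {α β : ℝ} (hα : 0 < α) (hβ : 0 < β) :
    IntegrableOn (gammaGammaPDF α β) (Ioi 0) := by
  have := (hasMellin_gammaGammaPDF (s := 0) hα hβ (by simpa) (by simpa)).1
  have h := Integrable.re this
  refine h.congr (ae_of_all _ fun x => ?_)
  simp

/-- Integrability of the density is the convergence of its Mellin transform at `1`. -/
theorem integrable_gammaGammaPDF {α β : ℝ} (hα : 0 < α) (hβ : 0 < β) :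
    Integrable (gammaGammaPDF α β) := by
  have h := (integrable_indicator_iff measurableSet_Ioi).2 (integrableOn_gammaGammaPDF hα hβ)
  refine h.congr (ae_of_all _ fun x => ?_)
  by_cases hx : 0 < x <;> simp [indicator, hx, gammaGammaPDF]

theorem gammaGammaCDF_eq_integral {α β : ℝ} (hα : 0 < α) (hβ : 0 < β) (x : ℝ) :
    gammaGammaCDF α β x = ∫ t in Iic x, gammaGammaPDF α β t := by
  rw [gammaGammaCDF, gammaGammaMeasure, measureReal_def, withDensity_apply _ measurableSet_Iic,
    integral_eq_lintegral_of_nonneg_ae (ae_of_all _ (gammaGammaPDF_nonneg hα hβ))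
      (integrable_gammaGammaPDF hα hβ).integrableOn.aestronglyMeasurable]

theorem continuous_gammaGammaCDF {α β : ℝ} (hα : 0 < α) (hβ : 0 < β) :
    Continuous (gammaGammaCDF α β) := by
  have hi := integrable_gammaGammaPDF hα hβ
  have : gammaGammaCDF α β = fun x => (∫ t in Iic (0 : ℝ), gammaGammaPDF α β t) +
      ∫ t in (0 : ℝ)..x, gammaGammaPDF α β t := by
    funext x
    rw [gammaGammaCDF_eq_integral hα hβ,
      ← intervalIntegral.integral_Iic_sub_Iic hi.integrableOn hi.integrableOn]
    ring
  rw [this]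
  exact continuous_const.add
    (intervalIntegral.continuous_primitive (fun a b => hi.intervalIntegrable) 0)

theorem hasMellin_gammaGammaCDF {α β : ℝ} (hα : 0 < α) (hβ : 0 < β) {s : ℂ}
    (h1 : 0 < (α + s).re) (h2 : 0 < (β + s).re) (hs : s.re < 0) :
    HasMellin (fun x => (gammaGammaCDF α β x : ℂ)) s
      (-(1 / s) * (((α * β : ℝ) : ℂ) ^ (-s) * (Gamma (α + s) * Gamma (β + s)) /
        (Gamma α * Gamma β))) := by
  have hf := hasMellin_gammaGammaPDF hα hβ h1 h2
  set h : ℝ → ℂ := fun t => (t : ℂ) ^ (1 : ℂ) • (gammaGammaPDF α β t : ℂ)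
  have hh : HasMellin h s (((α * β : ℝ) : ℂ) ^ (-s) * (Gamma (α + s) * Gamma (β + s)) /
        (Gamma α * Gamma β)) := by
    rw [HasMellin, MellinConvergent.cpow_smul, mellin_cpow_smul]; exact hf
  have hc := hasMellin_mulConv (g := (Ici (1 : ℝ)).indicator fun _ => (1 : ℂ))
    (measurable_const.indicator measurableSet_Ici) (hasMellin_indicator_Ici hs) hh
  have hval : ∀ x ∈ Ioi (0 : ℝ), (gammaGammaCDF α β x : ℂ) =
      mulConv ((Ici (1 : ℝ)).indicator fun _ => (1 : ℂ)) h x := by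
    intro x hx
    have hx' : (0 : ℝ) < x := hx
    rw [gammaGammaCDF_eq_integral hα hβ, ← integral_complex_ofReal, mulConv,
      ← integral_indicator measurableSet_Iic, ← integral_indicator measurableSet_Ioi]
    refine integral_congr_ae (ae_of_all _ fun t => ?_)
    -- the density vanishes for `t ≤ 0`
    by_cases ht : 0 < t
    · have ht0 : (t : ℂ) ≠ 0 := ofReal_ne_zero.2 ht.ne'
      by_cases htx : t ≤ x
      · have : 1 ≤ x / t := (one_le_div ht).2 htx
        simp [indicator, ht, htx, this, h, ht0]
      · have : ¬ 1 ≤ x / t := by rwa [one_le_div ht]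
        simp [indicator, htx, this]
    · simp [indicator, ht, gammaGammaPDF]
  rw [← hc.2]
  refine ⟨?_, ?_⟩
  · refine (integrableOn_congr_fun (fun x hx => ?_) measurableSet_Ioi).1 hc.1
    simp only [hval x hx]
  · refine setIntegral_congr_fun measurableSet_Ioi fun x hx => ?_
    simp only [hval x hx]

/-- The Mellin transform of the distribution function is `O(1 / (1 + y²))` on the line
`Re s = -c`: the factor `1 / s` gives one power of `y`, and one of the two Gamma factors gives the
other by `norm_Gamma_mul_norm_le`. -/
theorem verticalIntegrable_mellin_gammaGammaCDF {α β c : ℝ} (hα : 0 < α) (hβ : 0 < β)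
    (hc : 0 < c) (hcα : c < α) (hcβ : c < β) :
    VerticalIntegrable (mellin fun x => (gammaGammaCDF α β x : ℂ)) ((-c : ℝ) : ℝ) := by
  have hab : 0 < α * β := mul_pos hα hβ
  have hre : ∀ y : ℝ, (((-c : ℝ) : ℂ) + y * I).re = -c := by intro y; simp
  have hval : ∀ y : ℝ, mellin (fun x => (gammaGammaCDF α β x : ℂ)) (((-c : ℝ) : ℂ) + y * I) =
      -(1 / (((-c : ℝ) : ℂ) + y * I)) * (((α * β : ℝ) : ℂ) ^ (-(((-c : ℝ) : ℂ) + y * I)) *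
        (Gamma (α + (((-c : ℝ) : ℂ) + y * I)) * Gamma (β + (((-c : ℝ) : ℂ) + y * I))) /
        (Gamma α * Gamma β)) := by
    intro y
    refine (hasMellin_gammaGammaCDF hα hβ ?_ ?_ ?_).2
    · rw [add_re, hre, ofReal_re]; linarith
    · rw [add_re, hre, ofReal_re]; linarith
    · rw [hre]; linarith
  have hne : ∀ y : ℝ, ((-c : ℝ) : ℂ) + y * I ≠ 0 := by
    intro y h0
    have := hre y
    rw [h0, zero_re] at this
    linarith
  have hG : ∀ γ : ℝ, c < γ → Continuous fun y : ℝ => Gamma (γ + (((-c : ℝ) : ℂ) + y * I)) := by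
    intro γ hγ
    refine continuous_iff_continuousAt.2 fun y => ?_
    have hd : DifferentiableAt ℂ Gamma (γ + (((-c : ℝ) : ℂ) + y * I)) := by
      refine differentiableAt_Gamma _ fun m hm => ?_
      have := congrArg re hm
      rw [add_re, hre, ofReal_re, neg_re, natCast_re] at this
      have : (0 : ℝ) ≤ m := m.cast_nonneg
      linarith
    exact hd.continuousAt.comp (f := fun y : ℝ => (γ : ℂ) + (((-c : ℝ) : ℂ) + y * I))
      (by fun_prop)
  rw [VerticalIntegrable]
  simp_rw [hval]
  -- `m` is chosen so that `m² (1 + y²) ≤ |z|²` for both `z = s` and `z = α + s`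
  set m : ℝ := min c (min (α - c) 1)
  have hm : 0 < m := lt_min hc (lt_min (by linarith) one_pos)
  set K : ℝ := (α * β) ^ c * Real.Gamma (α - c + 1) * Real.Gamma (β - c) /
    (‖Gamma α‖ * ‖Gamma β‖)
  have hgb : 0 < Real.Gamma (β - c) := Real.Gamma_pos_of_pos (by linarith)
  have hga : 0 < Real.Gamma (α - c + 1) := Real.Gamma_pos_of_pos (by linarith)
  have hK : 0 ≤ K := by positivity
  refine (integrable_inv_one_add_sq.const_mul (K / m ^ 2)).mono' ?_ (ae_of_all _ fun y => ?_)
  · refine Continuous.aestronglyMeasurable ?_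
    have h1 : Continuous fun y : ℝ => ((α * β : ℝ) : ℂ) ^ (-(((-c : ℝ) : ℂ) + y * I)) :=
      Continuous.const_cpow (by fun_prop) (Or.inl (ofReal_ne_zero.2 hab.ne'))
    exact (continuous_const.div (by fun_prop) hne).neg.mul
      ((h1.mul ((hG α hcα).mul (hG β hcβ))).div_const _)
  · set w : ℂ := ((-c : ℝ) : ℂ) + y * I
    have hwre : w.re = -c := hre y
    have hwim : w.im = y := by simp [w]
    have hawre : ((α : ℂ) + w).re = α - c := by rw [add_re, hwre, ofReal_re]; ring
    have hbwre : ((β : ℂ) + w).re = β - c := by rw [add_re, hwre, ofReal_re]; ring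
    have hawim : ((α : ℂ) + w).im = y := by rw [add_im, hwim, ofReal_im]; ring
    have hA : ‖Gamma (α + w)‖ * ‖(α : ℂ) + w‖ ≤ Real.Gamma (α - c + 1) := by
      have := norm_Gamma_mul_norm_le (s := α + w) (by rw [hawre]; linarith)
      rwa [hawre] at this
    have hB : ‖Gamma (β + w)‖ ≤ Real.Gamma (β - c) := by
      have := norm_Gamma_le_Gamma_re (s := β + w) (by rw [hbwre]; linarith)
      rwa [hbwre] at this
    have hlow : ∀ z : ℂ, m ≤ |z.re| → z.im = y → m ^ 2 * (1 + y ^ 2) ≤ ‖z‖ ^ 2 := by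
      intro z hz1 hz2
      rw [← normSq_eq_norm_sq, normSq_apply, hz2]
      have a1 : m ^ 2 ≤ z.re ^ 2 := by
        rw [← sq_abs z.re]; exact pow_le_pow_left₀ hm.le hz1 2
      have a2 : m ^ 2 ≤ 1 := pow_le_one₀ hm.le ((min_le_right _ _).trans (min_le_right _ _))
      nlinarith [sq_nonneg y]
    have hw : m ^ 2 * (1 + y ^ 2) ≤ ‖w‖ ^ 2 := by
      refine hlow w ?_ hwim
      rw [hwre, abs_neg, abs_of_pos hc]; exact min_le_left _ _
    have haw : m ^ 2 * (1 + y ^ 2) ≤ ‖(α : ℂ) + w‖ ^ 2 := by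
      refine hlow _ ?_ hawim
      rw [hawre, abs_of_pos (by linarith)]; exact (min_le_right _ _).trans (min_le_left _ _)
    have hprod : m ^ 2 * (1 + y ^ 2) ≤ ‖(α : ℂ) + w‖ * ‖w‖ := by
      refine le_of_sq_le_sq ?_ (by positivity)
      rw [mul_pow _ ‖w‖, sq (m ^ 2 * (1 + y ^ 2))]
      exact mul_le_mul haw hw (by positivity) (by positivity)
    have hpos : 0 < m ^ 2 * (1 + y ^ 2) := by positivity
    have hwpos : 0 < ‖w‖ := norm_pos_iff.2 (hne y)
    have hawpos : 0 < ‖(α : ℂ) + w‖ := by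
      by_contra h0
      have : ‖(α : ℂ) + w‖ = 0 := le_antisymm (not_lt.1 h0) (norm_nonneg _)
      rw [this, zero_mul] at hprod; linarith
    have hp : ‖((α * β : ℝ) : ℂ) ^ (-w)‖ = (α * β) ^ c := by
      rw [norm_cpow_eq_rpow_re_of_pos hab, neg_re, hwre, neg_neg]
    have hA' : ‖Gamma (α + w)‖ ≤ Real.Gamma (α - c + 1) / ‖(α : ℂ) + w‖ := by
      rwa [le_div_iff₀ hawpos]
    calc ‖-(1 / w) * (((α * β : ℝ) : ℂ) ^ (-w) * (Gamma (α + w) * Gamma (β + w)) /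
          (Gamma α * Gamma β))‖
        = 1 / ‖w‖ * ((α * β) ^ c * (‖Gamma (α + w)‖ * ‖Gamma (β + w)‖) /
          (‖Gamma α‖ * ‖Gamma β‖)) := by
          rw [norm_mul, norm_neg, norm_div, norm_one, norm_div, norm_mul, norm_mul, norm_mul, hp]
      _ ≤ 1 / ‖w‖ * ((α * β) ^ c * (Real.Gamma (α - c + 1) / ‖(α : ℂ) + w‖ *
          Real.Gamma (β - c)) / (‖Gamma α‖ * ‖Gamma β‖)) := by gcongr
      _ = K / (‖(α : ℂ) + w‖ * ‖w‖) := by simp only [K]; field_simp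
      _ ≤ K / (m ^ 2 * (1 + y ^ 2)) := by gcongr
      _ = K / m ^ 2 * (1 + y ^ 2)⁻¹ := by field_simp

/-- Mellin inversion of the Gamma-Gamma distribution function on the line `Re s = -c`, which becomes
the Mellin-Barnes integral on `Re s = c` after `s ↦ -s`. -/
theorem gammaGammaCDF_eq_meijerG {α β x : ℝ} (hα : 0 < α) (hβ : 0 < β) (hx : 0 < x) :
    (gammaGammaCDF α β x : ℂ) = 1 / (Gamma α * Gamma β) *
      meijerG 2 1 ![(1 : ℂ)] ![(α : ℂ), (β : ℂ), 0] ((α * β * x : ℝ) : ℂ) := by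
  have hab : 0 < α * β := mul_pos hα hβ
  have habx : 0 < α * β * x := mul_pos hab hx
  have hsep : ∃ c : ℝ, IsSeparatingLine 2 1 ![(1 : ℂ)] ![(α : ℂ), (β : ℂ), 0] c := by
    refine ⟨min α β / 2, ?_, ?_⟩
    · intro j hj
      have := min_le_left α β
      have := min_le_right α β
      fin_cases j
      · simp; linarith
      · simp; linarith
      · simp at hj
    · intro j _
      fin_cases j
      simp [hα, hβ]
  rw [meijerG, dif_pos hsep]
  -- the line in `meijerG` is an arbitrary separating one; it satisfies `0 < c < min α β`
  obtain ⟨hc1, hc2⟩ := hsep.choose_spec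
  set c : ℝ := hsep.choose
  have hcα : c < α := by simpa using hc1 0 (by simp)
  have hcβ : c < β := by simpa using hc1 1 (by simp)
  have hc : 0 < c := by simpa using hc2 0 (by simp)
  have hconv : MellinConvergent (fun x => (gammaGammaCDF α β x : ℂ)) ((-c : ℝ) : ℂ) := by
    refine (hasMellin_gammaGammaCDF hα hβ ?_ ?_ ?_).1
    · rw [add_re, ofReal_re, ofReal_re]; linarith
    · rw [add_re, ofReal_re, ofReal_re]; linarith
    · rw [ofReal_re]; linarith
  have hinv := mellinInv_mellin_eq (-c) (fun x => (gammaGammaCDF α β x : ℂ)) hx hconv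
    (verticalIntegrable_mellin_gammaGammaCDF hα hβ hc hcα hcβ)
    (continuous_ofReal.comp (continuous_gammaGammaCDF hα hβ)).continuousAt
  rw [← hinv, mellinInv, ← integral_neg_eq_self]
  have hval : ∀ t : ℝ, (x : ℂ) ^ (-(((-c : ℝ) : ℂ) + ((-t : ℝ) : ℂ) * I)) •
        mellin (fun x => (gammaGammaCDF α β x : ℂ)) (((-c : ℝ) : ℂ) + ((-t : ℝ) : ℂ) * I) =
      1 / (Gamma α * Gamma β) * meijerGIntegrand 2 1 ![(1 : ℂ)] ![(α : ℂ), (β : ℂ), 0]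
        ((α * β * x : ℝ) : ℂ) (c + t * I) := by
    intro t
    -- `Γ(s) / Γ(1 + s) = 1 / s`
    set s : ℂ := c + t * I
    have hs : ((-c : ℝ) : ℂ) + ((-t : ℝ) : ℂ) * I = -s := by simp only [s]; push_cast; ring
    have hsre : s.re = c := by simp [s]
    have hs0 : s ≠ 0 := by
      intro h0; rw [h0, zero_re] at hsre; linarith
    have hGs : Gamma s ≠ 0 := Gamma_ne_zero_of_re_pos (by rw [hsre]; exact hc)
    have hM := (hasMellin_gammaGammaCDF (s := -s) hα hβ (by simp [hsre]; linarith)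
      (by simp [hsre]; linarith) (by simp [hsre, hc])).2
    rw [hs, hM, neg_neg, ofReal_mul (α * β) x, mul_comm ((α * β : ℝ) : ℂ) (x : ℂ),
      meijerGIntegrand, mul_cpow_ofReal_nonneg hx.le hab.le]
    simp [Fin.prod_univ_three]
    rw [add_comm 1 s, Gamma_add_one _ hs0]
    simp only [sub_eq_add_neg]
    field_simp
  simp_rw [hval]
  rw [integral_const_mul, integral_mul_const]
  have hpi : (Real.pi : ℂ) ≠ 0 := ofReal_ne_zero.2 Real.pi_ne_zero
  rw [real_smul]
  generalize (∫ t : ℝ, meijerGIntegrand 2 1 ![(1 : ℂ)] ![(α : ℂ), (β : ℂ), 0]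
    ((α * β * x : ℝ) : ℂ) (c + t * I)) = J
  push_cast
  field_simp

end Mellin

open MeasureTheory Set ProbabilityTheory

/-! ### Outage events -/

/-- Since the Gamma-Gamma distribution lives on `(0, ∞)` and has no atoms, the event `|h| < x` that
results from squaring the gain has the probability of `h ≤ x`. -/
theorem gammaGammaMeasure_real_Ioo_neg (α β : ℝ) {x : ℝ} (hx : 0 < x) :
    (gammaGammaMeasure α β).real (Ioo (-x) x) = gammaGammaCDF α β x := by
  have h0 : gammaGammaMeasure α β (Iic 0) = 0 := by
    rw [gammaGammaMeasure, withDensity_apply _ measurableSet_Iic,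
      setLIntegral_congr_fun (g := fun _ => 0) measurableSet_Iic fun t ht => ?_, lintegral_zero]
    have : ¬ 0 < t := not_lt.2 ht
    simp [gammaGammaPDF, this]
  have h1 : gammaGammaMeasure α β {x} = 0 :=
    withDensity_absolutelyContinuous _ _ Real.volume_singleton
  have h2 : ∀ᵐ t ∂gammaGammaMeasure α β, t ∉ Iic 0 := measure_eq_zero_iff_ae_notMem.1 h0
  have h3 : ∀ᵐ t ∂gammaGammaMeasure α β, t ∉ ({x} : Set ℝ) := measure_eq_zero_iff_ae_notMem.1 h1
  rw [gammaGammaCDF]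
  refine measureReal_congr ?_
  filter_upwards [h2, h3] with t ht htx
  have ht' : 0 < t := not_le.1 ht
  refine propext ⟨fun h => le_of_lt h.2, fun h => ⟨by linarith, lt_of_le_of_ne h htx⟩⟩

namespace RelaySystem

variable {N : ℕ} {Ω : Type*} (S : RelaySystem N)

theorem powerMargin_pos : 0 < S.powerMargin := by
  have := S.η_pos
  have := S.Tb_pos
  have := S.Pt_pos
  have := mul_pos S.N₀_pos S.γth_pos
  unfold powerMargin
  positivity

theorem linkOutage_eq_preimage (fading : Fin N → Hop → Ω → ℝ) (b : Fin N) (k : Hop) :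
    S.linkOutage fading b k = fading b k ⁻¹' Ioo (-(1 / (S.hbar b k * S.ρ b k * S.powerMargin)))
      (1 / (S.hbar b k * S.ρ b k * S.powerMargin)) := by
  ext ω
  have hM := S.powerMargin_pos
  have hh := S.hbar_pos b k
  have hρ := S.ρ_pos b k
  have hN := S.N₀_pos
  have hγ := S.γth_pos
  have hsnr : S.snr fading b k ω =
      S.γth * (S.hbar b k * S.ρ b k * S.powerMargin * fading b k ω) ^ 2 := by
    have hsq : S.powerMargin ^ 2 = (S.η * S.Tb * S.Pt) ^ 2 / (S.N₀ * S.γth) := by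
      rw [powerMargin, div_pow, Real.sq_sqrt (by positivity)]
    rw [snr, gain, mul_pow, mul_pow _ (fading b k ω), mul_pow _ S.powerMargin, hsq]
    field_simp
  rw [linkOutage, mem_ofPred_eq, hsnr, mem_preimage, mem_Ioo, ← abs_lt, lt_div_iff₀ (by positivity),
    mul_lt_iff_lt_one_right hγ, sq_lt_one_iff_abs_lt_one, abs_mul,
    abs_of_pos (by positivity : 0 < S.hbar b k * S.ρ b k * S.powerMargin), mul_comm]

/-- Under select-max relaying the system is in outage exactly when every path is: the activated path
has the largest minimal SNR. -/
theorem outage_eq_iInter {fading : Fin N → Hop → Ω → ℝ} {sel : Ω → Fin N}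
    (hsel : S.IsSelectMax fading sel) :
    S.outage fading sel = ⋂ b, (S.linkOutage fading b Hop.SR ∪ S.linkOutage fading b Hop.RD) := by
  ext ω
  simp only [outage, linkOutage, mem_ofPred_eq, mem_iInter, mem_union, ← min_lt_iff]
  exact ⟨fun h b => (hsel ω b).trans_lt h, fun h => h _⟩

end RelaySystem

theorem measureReal_union_of_indepFun {Ω : Type*} [MeasurableSpace Ω] {P : Measure Ω}
    [IsProbabilityMeasure P] {X Y : Ω → ℝ} (hY : AEMeasurable Y P)
    (h : IndepFun X Y P) {A B : Set ℝ} (hA : MeasurableSet A) (hB : MeasurableSet B) :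
    P.real (X ⁻¹' A ∪ Y ⁻¹' B) = 1 - (1 - P.real (X ⁻¹' A)) * (1 - P.real (Y ⁻¹' B)) := by
  have h1 := measureReal_union_add_inter₀ (s := X ⁻¹' A) (hY.nullMeasurable hB)
  have h2 : P.real (X ⁻¹' A ∩ Y ⁻¹' B) = P.real (X ⁻¹' A) * P.real (Y ⁻¹' B) := by
    simp [measureReal_def, h.measure_inter_preimage_eq_mul _ _ hA hB]
  rw [h2] at h1
  linarith

/-- For independent variables indexed by `ι × Hop`, the probability that for each `b` at least one
of the two events of `b` occurs. The variables are only almost everywhere measurable. -/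
theorem measureReal_iInter_union_of_iIndepFun {ι Ω : Type*} [Fintype ι] [MeasurableSpace Ω]
    {P : Measure Ω} [IsProbabilityMeasure P] {X : ι → Hop → Ω → ℝ}
    (hX : ∀ b k, AEMeasurable (X b k) P)
    (hindep : iIndepFun (fun l : ι × Hop => X l.1 l.2) P)
    {A : ι → Hop → Set ℝ} (hA : ∀ b k, MeasurableSet (A b k)) :
    P.real (⋂ b, (X b Hop.SR ⁻¹' A b Hop.SR ∪ X b Hop.RD ⁻¹' A b Hop.RD)) =
      ∏ b, (1 - (1 - P.real (X b Hop.SR ⁻¹' A b Hop.SR)) *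
        (1 - P.real (X b Hop.RD ⁻¹' A b Hop.RD))) := by
  classical
  set E : ι → Set Ω := fun b => X b Hop.SR ⁻¹' A b Hop.SR ∪ X b Hop.RD ⁻¹' A b Hop.RD
  have hne : ∀ b, ((b, Hop.SR) : ι × Hop) ≠ (b, Hop.RD) := fun b h => by simp at h
  have hE : ∀ b, P.real (E b) = 1 - (1 - P.real (X b Hop.SR ⁻¹' A b Hop.SR)) *
        (1 - P.real (X b Hop.RD ⁻¹' A b Hop.RD)) := fun b =>
    measureReal_union_of_indepFun (hX b _) (hindep.indepFun (hne b)) (hA b _) (hA b _)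
  -- adding one index at a time: the pair of variables of `a` is independent of those of `t`
  have key : ∀ t : Finset ι, P.real (⋂ b ∈ t, E b) = ∏ b ∈ t, P.real (E b) := by
    intro t
    induction t using Finset.induction_on with
    | empty => simp
    | insert a t ha ih =>
      have hmem : ∀ k : Hop, k ∈ ({Hop.SR, Hop.RD} : Finset Hop) := fun k => by cases k <;> simp
      set U : Finset (ι × Hop) := {a} ×ˢ {Hop.SR, Hop.RD}
      set V : Finset (ι × Hop) := t ×ˢ {Hop.SR, Hop.RD}
      have hUV : Disjoint U V := Finset.disjoint_left.2 fun l h1 h2 => by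
        have e1 := Finset.mem_singleton.1 (Finset.mem_product.1 h1).1
        exact ha (e1 ▸ (Finset.mem_product.1 h2).1)
      have hind := hindep.indepFun_finset₀ U V hUV fun l => hX l.1 l.2
      have haU : ∀ k, (a, k) ∈ U := fun k =>
        Finset.mem_product.2 ⟨Finset.mem_singleton_self a, hmem k⟩
      have hbV : ∀ b : t, ∀ k, ((b : ι), k) ∈ V := fun b k =>
        Finset.mem_product.2 ⟨b.2, hmem k⟩
      let B : Set (U → ℝ) := {v | v ⟨_, haU Hop.SR⟩ ∈ A a Hop.SR} ∪
        {v | v ⟨_, haU Hop.RD⟩ ∈ A a Hop.RD}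
      let C : Set (V → ℝ) := ⋂ b : t, ({v | v ⟨_, hbV b Hop.SR⟩ ∈ A b Hop.SR} ∪
        {v | v ⟨_, hbV b Hop.RD⟩ ∈ A b Hop.RD})
      have hm : ∀ (W : Finset (ι × Hop)) (l : W) {s : Set ℝ}, MeasurableSet s →
          MeasurableSet {v : W → ℝ | v l ∈ s} := fun W l s hs =>
        hs.preimage (measurable_pi_apply l)
      have hB : MeasurableSet B := (hm U _ (hA _ _)).union (hm U _ (hA _ _))
      have hC : MeasurableSet C := MeasurableSet.iInter fun b =>
        (hm V _ (hA _ _)).union (hm V _ (hA _ _))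
      have hmul := hind.measure_inter_preimage_eq_mul _ _ hB hC
      have eB : (fun ω (l : U) => X l.1.1 l.1.2 ω) ⁻¹' B = E a := rfl
      have eC : (fun ω (l : V) => X l.1.1 l.1.2 ω) ⁻¹' C = ⋂ b ∈ t, E b := by
        ext ω; simp [C, E]
      rw [eB, eC] at hmul
      rw [Finset.set_biInter_insert, Finset.prod_insert ha, ← ih, measureReal_def, hmul,
        ENNReal.toReal_mul, measureReal_def, measureReal_def]
  have := key Finset.univ
  simp only [Finset.mem_univ, iInter_true] at this
  rw [this]
  exact Finset.prod_congr rfl fun b _ => hE b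

end FSO

theorem theorem4 {N : ℕ} (S : FSO.RelaySystem N)
    {Ω : Type*} [MeasurableSpace Ω] (P : MeasureTheory.Measure Ω)
    [MeasureTheory.IsProbabilityMeasure P]
    (fading : Fin N → FSO.Hop → Ω → ℝ)
    (hlaw : ∀ b k, ProbabilityTheory.HasLaw (fading b k)
      (FSO.gammaGammaMeasure (S.α b k) (S.β b k)) P)
    (hindep : ProbabilityTheory.iIndepFun
      (fun l : Fin N × FSO.Hop => fading l.1 l.2) P)
    (sel : Ω → Fin N) (hsel : S.IsSelectMax fading sel) :
    (∀ b k,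
      P.real (S.linkOutage fading b k) =
          FSO.gammaGammaCDF (S.α b k) (S.β b k) (1 / (S.hbar b k * S.ρ b k * S.powerMargin)) ∧
      ((P.real (S.linkOutage fading b k) : ℝ) : ℂ) = S.linkOutageFormula b k) ∧
    ((P.real (S.outage fading sel) : ℝ) : ℂ) =
      ∏ b : Fin N,
        (1 - (1 - S.linkOutageFormula b FSO.Hop.SR) * (1 - S.linkOutageFormula b FSO.Hop.RD)) := by
  have hpos : ∀ b k, 0 < 1 / (S.hbar b k * S.ρ b k * S.powerMargin) := fun b k =>
    one_div_pos.2 (mul_pos (mul_pos (S.hbar_pos b k) (S.ρ_pos b k)) S.powerMargin_pos)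
  have hcdf : ∀ b k, P.real (S.linkOutage fading b k) =
      FSO.gammaGammaCDF (S.α b k) (S.β b k) (1 / (S.hbar b k * S.ρ b k * S.powerMargin)) := by
    intro b k
    rw [S.linkOutage_eq_preimage, ← FSO.gammaGammaMeasure_real_Ioo_neg _ _ (hpos b k),
      ← (hlaw b k).map_eq, MeasureTheory.map_measureReal_apply_of_aemeasurable (hlaw b k).aemeasurable
        measurableSet_Ioo]
  have hformula : ∀ b k,
      ((P.real (S.linkOutage fading b k) : ℝ) : ℂ) = S.linkOutageFormula b k := by
    intro b k
    rw [hcdf, FSO.gammaGammaCDF_eq_meijerG (S.α_pos b k) (S.β_pos b k) (hpos b k),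
      FSO.RelaySystem.linkOutageFormula, mul_one_div]
  refine ⟨fun b k => ⟨hcdf b k, hformula b k⟩, ?_⟩
  have hprod := FSO.measureReal_iInter_union_of_iIndepFun (fun b k => (hlaw b k).aemeasurable)
    hindep (A := fun b k => Set.Ioo (-(1 / (S.hbar b k * S.ρ b k * S.powerMargin)))
      (1 / (S.hbar b k * S.ρ b k * S.powerMargin))) fun b k => measurableSet_Ioo
  simp only [← S.linkOutage_eq_preimage] at hprod
  rw [S.outage_eq_iInter hsel, hprod]
  push_cast
  simp only [hformula]
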